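/- Let $d\ge 1$ and let $U\colon\mathbb{R}^d\to\mathbb{R}$ be of class $C^3$ with finitely many critical points, all non-degenerate (that is, $\det\nabla^2U(x)\neq0$ whenever $\nabla U(x)=0$), such that, as $|x|\to\infty$, $$\frac{U(x)}{|x|}\to\infty,\qquad \frac{x}{|x|}\cdot\nabla U(x)\to\infty,\qquad |\nabla U(x)|-2\,\Delta U(x)\to\infty .$$ Let $\mathcal{M}_0$ be the set of local minima of $U$, and assume that it has at least two elements. For $m',m''\in\mathcal{M}_0$, $m'\neq m''$, let $$\Theta(m',m'')=\inf_{z}\max_{t\in[0,1]}U(z(t)),$$ where the infimum is over all continuous $z\colon[0,1]\to\mathbb{R}^d$ with $z(0)=m'$ and $z(1)=m''$, and for $m\in\mathcal{M}_0$ let $$\Gamma(m)=\min_{m'\in\mathcal{M}_0,\,m'\neq m}\Theta(m,m')-U(m).$$ Fix $m\in\mathcal{M}_0$. Then there exist $m'\in\mathcal{M}_0$, $m'\neq m$, and a continuous path $z\colon[0,1]\to\mathbb{R}^d$ with $z(0)=m$, $z(1)=m'$ such that $$\max_{t\in[0,1]}U(z(t))=U(z(1/2))=U(m)+\Gamma(m)=\Theta(m,m'),\qquad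 U(z(s))<U(z(1/2))\ \text{ for all } s\in[0,1]\setminus\{1/2\}.$$ Moreover, for every $m'\in\mathcal{M}_0$, $m'\neq m$, and every such path $z$ from $m$ to $m'$, the point $z(1/2)$ is a saddle point of $U$ of index one: $\nabla U(z(1/2))=0$, and $\nabla^2U(z(1/2))$ has exactly one negative eigenvalue (counted with multiplicity), all the others being strictly positive. -/

import Mathlib

open Filter Topology

namespace MorsePotential

variable {d : ℕ}

/-- The Hessian matrix `∇²U(x)`, with entries `∂ᵢ∂ⱼU(x)`. -/
noncomputable def hessian (U : EuclideanSpace ℝ (Fin d) → ℝ) (x : EuclideanSpace ℝ (Fin d)) :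
    Matrix (Fin d) (Fin d) ℝ :=
  Matrix.of fun i j =>
    fderiv ℝ (fderiv ℝ U) x (EuclideanSpace.single i 1) (EuclideanSpace.single j 1)

/-- The standing assumptions on the potential: `U ∈ C³(ℝᵈ)` has finitely many critical points,
all of them non-degenerate, and satisfies the three growth conditions at infinity. -/
structure IsAdmissible (U : EuclideanSpace ℝ (Fin d) → ℝ) : Prop where
  contDiff : ContDiff ℝ 3 U
  finite_critical : {x | gradient U x = 0}.Finite
  nondegenerate : ∀ x, gradient U x = 0 → (hessian U x).det ≠ 0
  /-- `U(x) / |x| → ∞` as `|x| → ∞` -/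
  superlinear : Tendsto (fun x => U x / ‖x‖) (Bornology.cobounded _) atTop
  /-- `(x / |x|) · ∇U(x) → ∞` as `|x| → ∞` -/
  radial_gradient :
    Tendsto (fun x => inner ℝ (‖x‖⁻¹ • x) (gradient U x)) (Bornology.cobounded _) atTop
  /-- `|∇U(x)| - 2 ΔU(x) → ∞` as `|x| → ∞` -/
  gradient_laplacian :
    Tendsto (fun x => ‖gradient U x‖ - 2 * Laplacian.laplacian U x) (Bornology.cobounded _) atTop

/-- The communication height `Θ(x, y)`: the infimum over all continuous paths from `x` to `y`
of the maximum of `U` along the path. -/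
noncomputable def commHeight (U : EuclideanSpace ℝ (Fin d) → ℝ)
    (x y : EuclideanSpace ℝ (Fin d)) : ℝ :=
  ⨅ z : Path x y, ⨆ t : unitInterval, U (z t)

/-- The depth `Γ(m)`: the minimum of `Θ(m, m')` over the local minima `m' ≠ m`, minus `U(m)`. -/
noncomputable def depth (U : EuclideanSpace ℝ (Fin d) → ℝ) (m : EuclideanSpace ℝ (Fin d)) : ℝ :=
  sInf (commHeight U m '' {m' | IsLocalMin U m' ∧ m' ≠ m}) - U m

/-- The midpoint `1/2` of `[0,1]`. -/
noncomputable def half : unitInterval := ⟨1 / 2, by norm_num, by norm_num⟩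

/-- The path `z` from `m` to `m'` satisfies
`max U(z(t)) = U(z(1/2)) = U(m) + Γ(m) = Θ(m, m')`
and `U(z(s)) < U(z(1/2))` for all `s ≠ 1/2`. -/
structure IsOptimalPath (U : EuclideanSpace ℝ (Fin d) → ℝ) {m m' : EuclideanSpace ℝ (Fin d)}
    (z : Path m m') : Prop where
  max_eq : IsGreatest (Set.range fun t => U (z t)) (U (z half))
  eq_depth : U (z half) = U m + depth U m
  eq_commHeight : U m + depth U m = commHeight U m m'
  lt_of_ne : ∀ s, s ≠ half → U (z s) < U (z half)

/-- `σ` is a saddle point of `U`: a critical point at which the (symmetric) Hessian has exactly one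
negative eigenvalue, counted with multiplicity, all the others being strictly positive. -/
def IsSaddlePoint (U : EuclideanSpace ℝ (Fin d) → ℝ) (σ : EuclideanSpace ℝ (Fin d)) : Prop :=
  gradient U σ = 0 ∧
    ∃ hH : (hessian U σ).IsHermitian,
      ∃ i, hH.eigenvalues i < 0 ∧ ∀ j, j ≠ i → 0 < hH.eigenvalues j

end MorsePotential

namespace MorsePotential

/-! ### Strict sublevel sets near a point of the level. -/

section LocalAnalysis

open Set

variable {E : Type*} [NormedAddCommGroup E] [InnerProductSpace ℝ E] {U : E → ℝ} {σ : E}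

/-! Put `c = U m + depth U m` and let `A` be the path component of `m` in `{U < c}`. If the closures
of `A` and of `{U < c} \ A` were disjoint, the compact set `{U ≤ c}` would split into two disjoint
closed sets separating `m` from an optimal `m'`, and compactness would force the communication
height above `c`. So the closures share a point `σ`, at level `c`, and it is critical because `{U <
c}` is locally connected at noncritical points of the level.

No Morse lemma is needed at a nondegenerate critical point: with `S` the negative space of the
Hessian, convexity along `Sᗮ` pushes nearby points of `{U < c}` onto `S`, and a segment in `S` then
leads to `σ` (`IsMorseSplitting.exists_path`). Doing this from both sides of `σ`, and continuing to
a minimum in the other component, gives the path.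

For the index, an optimal path cannot be short-cut below its top
(`IsOptimalPath.not_eventually_joinedIn`). A short cut exists at a noncritical point, and at index
at least two because `S \ {0}` is then path connected; at index zero no nearby point lies below the
top. -/

theorem hasDerivAt_comp_line (hU : ContDiff ℝ 2 U) (x v : E) (s : ℝ) :
    HasDerivAt (fun s : ℝ => U (x + s • v)) (fderiv ℝ U (x + s • v) v) s := by
  have h1 : HasDerivAt (fun s : ℝ => x + s • v) v s := by
    simpa using ((hasDerivAt_id s).smul_const v).const_add x
  exact ((hU.differentiable (by norm_num)) (x + s • v)).hasFDerivAt.comp_hasDerivAt s h1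

theorem hasDerivAt_fderiv_comp_line (hU : ContDiff ℝ 2 U) (x v : E) (s : ℝ) :
    HasDerivAt (fun s : ℝ => fderiv ℝ U (x + s • v) v)
      (fderiv ℝ (fderiv ℝ U) (x + s • v) v v) s := by
  have h1 : HasDerivAt (fun s : ℝ => x + s • v) v s := by
    simpa using ((hasDerivAt_id s).smul_const v).const_add x
  have hd : Differentiable ℝ (fderiv ℝ U) :=
    (hU.fderiv_right (m := 1) (by norm_num)).differentiable (by norm_num)
  have h2 := (hd (x + s • v)).hasFDerivAt.comp_hasDerivAt s h1
  simpa using h2.clm_apply (hasDerivAt_const s v)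

theorem convexOn_comp_line (hU : ContDiff ℝ 2 U) {x v : E}
    (h : ∀ s ∈ Ioo (0 : ℝ) 1, 0 ≤ fderiv ℝ (fderiv ℝ U) (x + s • v) v v) :
    ConvexOn ℝ (Icc 0 1) fun s : ℝ => U (x + s • v) := by
  refine convexOn_of_hasDerivWithinAt2_nonneg (convex_Icc 0 1)
    (fun s _ => (hasDerivAt_comp_line hU x v s).continuousAt.continuousWithinAt)
    (fun s _ => (hasDerivAt_comp_line hU x v s).hasDerivWithinAt)
    (fun s _ => (hasDerivAt_fderiv_comp_line hU x v s).hasDerivWithinAt) ?_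
  intro s hs
  rw [interior_Icc] at hs
  exact h s hs

theorem lt_add_of_fderiv_fderiv_pos (hU : ContDiff ℝ 2 U) {x v : E} (h0 : fderiv ℝ U x v = 0)
    (h : ∀ s ∈ Ioo (0 : ℝ) 1, 0 < fderiv ℝ (fderiv ℝ U) (x + s • v) v v) :
    U x < U (x + v) := by
  have h1 : StrictMonoOn (fun s : ℝ => fderiv ℝ U (x + s • v) v) (Icc 0 1) := by
    refine strictMonoOn_of_deriv_pos (convex_Icc 0 1)
      (fun s _ => (hasDerivAt_fderiv_comp_line hU x v s).continuousAt.continuousWithinAt) ?_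
    intro s hs
    rw [interior_Icc] at hs
    rw [(hasDerivAt_fderiv_comp_line hU x v s).deriv]
    exact h s hs
  have h2 : StrictMonoOn (fun s : ℝ => U (x + s • v)) (Icc 0 1) := by
    refine strictMonoOn_of_deriv_pos (convex_Icc 0 1)
      (fun s _ => (hasDerivAt_comp_line hU x v s).continuousAt.continuousWithinAt) ?_
    intro s hs
    rw [interior_Icc] at hs
    rw [(hasDerivAt_comp_line hU x v s).deriv]
    have := h1 (left_mem_Icc.2 zero_le_one) (Ioo_subset_Icc_self hs) hs.1
    simpa [h0] using this
  simpa using h2 (left_mem_Icc.2 zero_le_one) (right_mem_Icc.2 zero_le_one) zero_lt_one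

theorem add_lt_of_fderiv_fderiv_neg (hU : ContDiff ℝ 2 U) {x v : E} (h0 : fderiv ℝ U x v = 0)
    (h : ∀ s ∈ Ioo (0 : ℝ) 1, fderiv ℝ (fderiv ℝ U) (x + s • v) v v < 0) :
    U (x + v) < U x := by
  have hd : fderiv ℝ (fun y => -U y) = fun y => -fderiv ℝ U y := funext fun y => fderiv_fun_neg
  have key := lt_add_of_fderiv_fderiv_pos (U := fun y => -U y) (x := x) (v := v) hU.neg
    (by simp [h0]) (fun s hs => by
      rw [hd, fderiv_fun_neg]
      simpa using h s hs)
  simpa using key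

/-- A splitting of the space at a nondegenerate critical point `σ`: on the ball of radius `r`,
`U` has a strict maximum at `σ` along `S`, a strict minimum along `Sᗮ`, and is convex in the
directions of `Sᗮ`. -/
structure IsMorseSplitting (U : E → ℝ) (σ : E) (S : Submodule ℝ E) (r : ℝ) : Prop where
  pos : 0 < r
  lt_of_mem : ∀ v ∈ S, v ≠ 0 → ‖v‖ < r → U (σ + v) < U σ
  lt_of_mem_orthogonal : ∀ w ∈ Sᗮ, w ≠ 0 → ‖w‖ < r → U σ < U (σ + w)
  convexOn : ∀ v ∈ S, ∀ w ∈ Sᗮ, ‖v‖ < r → ‖w‖ < r →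
    ConvexOn ℝ (Icc 0 1) fun s : ℝ => U (σ + v + s • w)

/-- The second derivative is continuous, so near `σ` it differs from its value at `σ` by less than
`c` in norm and keeps its signs on `S` and on `Sᗮ`. -/
theorem exists_isMorseSplitting (hU : ContDiff ℝ 2 U) (hσ : fderiv ℝ U σ = 0)
    (S : Submodule ℝ E) {c : ℝ} (hc : 0 < c)
    (hS : ∀ v ∈ S, fderiv ℝ (fderiv ℝ U) σ v v ≤ -(c * ‖v‖ ^ 2))
    (hT : ∀ w ∈ Sᗮ, c * ‖w‖ ^ 2 ≤ fderiv ℝ (fderiv ℝ U) σ w w) :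
    ∃ r, IsMorseSplitting U σ S r := by
  have hcont : Continuous (fderiv ℝ (fderiv ℝ U)) :=
    (hU.fderiv_right (m := 1) (by norm_num)).continuous_fderiv (by norm_num)
  have hev : ∀ᶠ x in 𝓝 σ, ‖fderiv ℝ (fderiv ℝ U) x - fderiv ℝ (fderiv ℝ U) σ‖ < c :=
    ((tendsto_iff_norm_sub_tendsto_zero (E := E →L[ℝ] E →L[ℝ] ℝ)).1
      (hcont.tendsto σ)).eventually_lt_const hc
  obtain ⟨r, hr, hball⟩ := Metric.eventually_nhds_iff.1 hev
  have hclose : ∀ x, ‖x‖ < r → ∀ v : E, v ≠ 0 →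
      |fderiv ℝ (fderiv ℝ U) (σ + x) v v - fderiv ℝ (fderiv ℝ U) σ v v| < c * ‖v‖ ^ 2 := by
    intro x hx v hv
    have h1 : ‖fderiv ℝ (fderiv ℝ U) (σ + x) - fderiv ℝ (fderiv ℝ U) σ‖ < c :=
      hball (by simpa using hx)
    have h2 := (fderiv ℝ (fderiv ℝ U) (σ + x) - fderiv ℝ (fderiv ℝ U) σ).le_opNorm₂ v v
    have hv' : 0 < ‖v‖ := norm_pos_iff.2 hv
    calc _ ≤ _ := by simpa using h2
      _ < c * ‖v‖ ^ 2 := by rw [mul_assoc, ← sq]; gcongr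
  have hsmul : ∀ v : E, ‖v‖ < r → ∀ s ∈ Ioo (0 : ℝ) 1, ‖s • v‖ ≤ ‖v‖ := by
    intro v _ s hs
    rw [norm_smul, Real.norm_of_nonneg hs.1.le]
    exact mul_le_of_le_one_left (norm_nonneg v) hs.2.le
  -- The radius is halved because convexity is tested at `v + s • w`, whose norm is bounded by the
  -- sum of the two norms.
  refine ⟨r / 2, by positivity, fun v hv hv0 hvr => ?_, fun w hw hw0 hwr => ?_,
    fun v hv w hw hvr hwr => ?_⟩
  · refine add_lt_of_fderiv_fderiv_neg hU (by simp [hσ]) fun s hs => ?_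
    have := (abs_lt.1 (hclose (s • v) (by linarith [hsmul v (by linarith) s hs]) v hv0)).2
    linarith [hS v hv]
  · refine lt_add_of_fderiv_fderiv_pos hU (by simp [hσ]) fun s hs => ?_
    have := (abs_lt.1 (hclose (s • w) (by linarith [hsmul w (by linarith) s hs]) w hw0)).1
    linarith [hT w hw]
  · refine convexOn_comp_line hU fun s hs => ?_
    rcases eq_or_ne w 0 with rfl | hw0
    · simp
    have hn : ‖v + s • w‖ < r := by
      linarith [norm_add_le v (s • w), hsmul w (by linarith) s hs]
    have := (abs_lt.1 (hclose _ hn w hw0)).1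
    rw [add_assoc]
    linarith [hT w hw]

namespace IsMorseSplitting

variable {r : ℝ}

theorem lt_of_bot (h : IsMorseSplitting U σ ⊥ r) {x : E} (hx : x ≠ σ) (hxr : ‖x - σ‖ < r) :
    U σ < U x := by
  simpa using h.lt_of_mem_orthogonal (x - σ) (by simp) (sub_ne_zero.2 hx) hxr

theorem eq_bot_of_isLocalMin {S : Submodule ℝ E} (h : IsMorseSplitting U σ S r)
    (hσ : IsLocalMin U σ) : S = ⊥ := by
  refine (Submodule.eq_bot_iff _).2 fun v hv => ?_
  by_contra hv0
  have ht : Tendsto (fun s : ℝ => σ + s • v) (𝓝[>] 0) (𝓝 σ) := by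
    have : Continuous fun s : ℝ => σ + s • v := by fun_prop
    simpa using (this.tendsto 0).mono_left nhdsWithin_le_nhds
  have hball := ht.eventually (Metric.ball_mem_nhds σ h.pos)
  obtain ⟨s, hs, hsr, hs0⟩ := ((ht.eventually hσ).and (hball.and self_mem_nhdsWithin)).exists
  refine not_lt.2 hs (h.lt_of_mem _ (S.smul_mem s hv) (smul_ne_zero (ne_of_gt hs0) hv0) ?_)
  simpa using hsr

theorem joinedIn_of_mem {S : Submodule ℝ E}
    (h : IsMorseSplitting U σ S r)
    (hS : 1 < Module.rank ℝ S) {v w : E} (hv : v ∈ S) (hw : w ∈ S) (hv0 : v ≠ 0) (hw0 : w ≠ 0) (hvr : ‖v‖ < r) (hwr : ‖w‖ < r) :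
    JoinedIn {x | U x < U σ} (σ + v) (σ + w) := by
  set ρ := max ‖v‖ ‖w‖ with hρ
  have hρ0 : 0 < ρ := lt_max_of_lt_left (norm_pos_iff.2 hv0)
  have hρr : ρ < r := max_lt hvr hwr
  have hpos : ∀ u : S, 0 < max ρ ‖u‖ := fun u => lt_max_of_lt_left hρ0
  -- Radial retraction of `S` onto the ball of radius `ρ`: it fixes `v` and `w`, never vanishes off
  -- `0`, and brings a path in `S \ {0}` back where the splitting applies.
  have hcont : Continuous fun u : S => σ + (ρ / max ρ ‖u‖) • (u : E) :=
    continuous_const.add ((continuous_const.div (continuous_const.max continuous_norm)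
      fun u => (hpos u).ne').smul continuous_subtype_val)
  have hj := ((isPathConnected_compl_singleton_of_one_lt_rank hS (0 : S)).joinedIn ⟨v, hv⟩
    (by simpa using hv0) ⟨w, hw⟩ (by simpa using hw0)).map hcont
  have hfix : ∀ u : E, ‖u‖ ≤ ρ → (ρ / max ρ ‖u‖) • u = u := fun u hu => by
    rw [max_eq_left hu, div_self hρ0.ne', one_smul]
  simp only [Submodule.coe_norm, hfix v (le_max_left _ _), hfix w (le_max_right _ _)] at hj
  refine hj.mono ?_
  rintro _ ⟨u, hu, rfl⟩
  have hu0 : (u : E) ≠ 0 := by simpa using hu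
  have hq : 0 < ρ / max ρ ‖u‖ := div_pos hρ0 (hpos u)
  refine h.lt_of_mem _ (S.smul_mem _ u.2) (smul_ne_zero hq.ne' hu0) ?_
  rw [norm_smul, ← Submodule.coe_norm, Real.norm_of_nonneg hq.le]
  refine lt_of_le_of_lt ?_ hρr
  rw [div_mul_eq_mul_div, div_le_iff₀ (hpos u)]
  exact mul_le_mul_of_nonneg_left (le_max_right _ _) hρ0.le

variable {S : Submodule ℝ E} [S.HasOrthogonalProjection]

theorem starProjection_ne_zero (h : IsMorseSplitting U σ S r) {w : E} (hw : ‖w‖ < r)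
    (hlt : U (σ + w) < U σ) : S.starProjection w ≠ 0 := by
  intro h0
  have hmem : w ∈ Sᗮ := by simpa [h0] using S.sub_starProjection_mem_orthogonal w
  rcases eq_or_ne w 0 with rfl | hw0
  · simp at hlt
  · exact lt_asymm hlt (h.lt_of_mem_orthogonal w hmem hw0 hw)

/-- `U` is convex on the segment from the projection to `w`, and both ends lie below `U σ`. -/
theorem joinedIn_starProjection (h : IsMorseSplitting U σ S r) {w : E} (hw : ‖w‖ < r)
    (hlt : U (σ + w) < U σ) :
    JoinedIn {x | U x < U σ} (σ + S.starProjection w) (σ + w) := by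
  have hP : ‖S.starProjection w‖ < r := (S.norm_starProjection_apply_le w).trans_lt hw
  have hQ : ‖w - S.starProjection w‖ < r := by
    rw [← S.starProjection_orthogonal_val]
    exact (Sᗮ.norm_starProjection_apply_le w).trans_lt hw
  have hPlt := h.lt_of_mem _ (S.starProjection_apply_mem w) (h.starProjection_ne_zero hw hlt) hP
  have hconv := h.convexOn _ (S.starProjection_apply_mem w) _
    (S.sub_starProjection_mem_orthogonal w) hP hQ
  refine JoinedIn.of_segment_subset ?_
  rw [segment_eq_image']
  rintro _ ⟨s, hs, rfl⟩
  have := hconv.2 (left_mem_Icc.2 zero_le_one) (right_mem_Icc.2 zero_le_one)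
    (sub_nonneg.2 hs.2) hs.1 (sub_add_cancel 1 s)
  simp only [smul_eq_mul, mul_zero, mul_one, zero_add, zero_smul, add_zero, one_smul] at this
  rw [show σ + S.starProjection w + (w - S.starProjection w) = σ + w by abel] at this
  rw [mem_ofPred_eq, show σ + w - (σ + S.starProjection w) = w - S.starProjection w by abel]
  refine this.trans_lt ?_
  rcases eq_or_lt_of_le hs.1 with rfl | hs0
  · simpa using hPlt
  · nlinarith [mul_lt_mul_of_pos_left hlt hs0,
      mul_le_mul_of_nonneg_left hPlt.le (sub_nonneg.2 hs.2)]

/-- Points below the critical level near `σ` can be joined to `σ` below that level. -/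
theorem exists_path (h : IsMorseSplitting U σ S r) {w y : E} (hw : ‖w‖ < r)
    (hy : JoinedIn {x | U x < U σ} y (σ + w)) :
    ∃ γ : Path y σ, ∀ t, t ≠ 1 → U (γ t) < U σ := by
  have hlt : U (σ + w) < U σ := hy.target_mem
  have hP : ‖S.starProjection w‖ < r := (S.norm_starProjection_apply_le w).trans_lt hw
  have hne := h.starProjection_ne_zero hw hlt
  obtain ⟨γ, hγ⟩ := hy.trans (h.joinedIn_starProjection hw hlt).symm
  let δ : Path (σ + S.starProjection w) σ :=
    ⟨⟨fun t => σ + (1 - (t : ℝ)) • S.starProjection w, by fun_prop⟩, by simp, by simp⟩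
  have hδ : ∀ t, t ≠ 1 → U (δ t) < U σ := by
    intro t ht
    have ht1 : (t : ℝ) < 1 := lt_of_le_of_ne t.2.2 fun h => ht (Subtype.ext h)
    refine h.lt_of_mem _ (S.smul_mem _ (S.starProjection_apply_mem w))
      (smul_ne_zero (by linarith) hne) ?_
    rw [norm_smul, Real.norm_of_nonneg (by linarith)]
    exact (mul_le_of_le_one_left (norm_nonneg _) (by linarith [t.2.1])).trans_lt hP
  refine ⟨γ.trans δ, fun t ht => ?_⟩
  rw [Path.trans_apply]
  split_ifs with hle
  · exact hγ _
  · refine hδ _ fun h1 => ht (Subtype.ext ?_)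
    have := congrArg Subtype.val h1
    simp only [Set.Icc.coe_one] at this ⊢
    linarith

/-- If `S` has dimension at least two, the sublevel set is locally path connected at `σ`. -/
theorem eventually_joinedIn (h : IsMorseSplitting U σ S r) (hS : 1 < Module.rank ℝ S) :
    ∃ W ∈ 𝓝 σ, ∀ x ∈ W, ∀ y ∈ W, U x < U σ → U y < U σ → JoinedIn {x | U x < U σ} x y := by
  refine ⟨_, Metric.ball_mem_nhds σ h.pos, fun x hx y hy hxU hyU => ?_⟩
  rw [mem_ball_iff_norm] at hx hy
  rw [← add_sub_cancel σ x] at hxU ⊢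
  rw [← add_sub_cancel σ y] at hyU ⊢
  refine ((h.joinedIn_starProjection hx hxU).symm.trans ?_).trans
    (h.joinedIn_starProjection hy hyU)
  exact h.joinedIn_of_mem hS (S.starProjection_apply_mem _) (S.starProjection_apply_mem _)
    (h.starProjection_ne_zero hx hxU) (h.starProjection_ne_zero hy hyU)
    ((S.norm_starProjection_apply_le _).trans_lt hx)
    ((S.norm_starProjection_apply_le _).trans_lt hy)

end IsMorseSplitting

/-- Near a noncritical point the strict sublevel set is locally path connected. -/
theorem eventually_joinedIn_of_fderiv_ne_zero (hU : ContDiff ℝ 1 U) (hσ : fderiv ℝ U σ ≠ 0) :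
    ∃ W ∈ 𝓝 σ, ∀ x ∈ W, ∀ y ∈ W, U x < U σ → U y < U σ → JoinedIn {x | U x < U σ} x y := by
  obtain ⟨v, hv⟩ : ∃ v, fderiv ℝ U σ v < 0 := by
    obtain ⟨v, hv⟩ := DFunLike.ne_iff.1 hσ
    rcases lt_or_gt_of_ne hv with h | h
    · exact ⟨v, by simpa using h⟩
    · exact ⟨-v, by simpa using h⟩
  have hdiff : Differentiable ℝ U := hU.differentiable (by norm_num)
  have hcont : Continuous fun x => fderiv ℝ U x v :=
    (hU.continuous_fderiv (by norm_num)).clm_apply continuous_const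
  obtain ⟨r, hr, hball⟩ := Metric.eventually_nhds_iff_ball.1
    (hcont.continuousAt.eventually_lt continuousAt_const hv)
  have hanti : ∀ x, ∀ a : ℝ, 0 < a → (∀ s ∈ Icc 0 a, x + s • v ∈ Metric.ball σ r) →
      StrictAntiOn (fun s : ℝ => U (x + s • v)) (Icc 0 a) := by
    intro x a ha hx
    have hd : ∀ s : ℝ, HasDerivAt (fun s : ℝ => U (x + s • v)) (fderiv ℝ U (x + s • v) v) s := by
      intro s
      have h1 : HasDerivAt (fun s : ℝ => x + s • v) v s := by
        simpa using ((hasDerivAt_id s).smul_const v).const_add x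
      exact (hdiff (x + s • v)).hasFDerivAt.comp_hasDerivAt s h1
    exact strictAntiOn_of_deriv_neg (convex_Icc 0 a)
      (fun s _ => (hd s).continuousAt.continuousWithinAt)
      (fun s hs => by rw [(hd s).deriv]; exact hball _ (hx s (interior_subset hs)))
  -- Flowing for time `a` moves points by less than `r / 2`, so starting points in the half ball
  -- stay where `U` decreases along `v`.
  set a : ℝ := r / (2 * (‖v‖ + 1)) with ha_def
  have ha : 0 < a := by positivity
  have hav : a * ‖v‖ < r / 2 := by
    rw [ha_def, div_mul_eq_mul_div, div_lt_div_iff₀ (by positivity) two_pos]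
    nlinarith [norm_nonneg v]
  have hmem : ∀ x ∈ Metric.ball σ (r / 2), ∀ s ∈ Icc 0 a, x + s • v ∈ Metric.ball σ r := by
    intro x hx s hs
    rw [mem_ball_iff_norm] at hx ⊢
    have h1 : ‖s • v‖ ≤ a * ‖v‖ := by
      rw [norm_smul, Real.norm_of_nonneg hs.1]
      exact mul_le_mul_of_nonneg_right hs.2 (norm_nonneg v)
    have h2 : x + s • v - σ = (x - σ) + s • v := by abel
    rw [h2]
    linarith [norm_add_le (x - σ) (s • v)]
  have hdown : U (σ + a • v) < U σ := by
    simpa using hanti σ a ha (hmem σ (Metric.mem_ball_self (by positivity)))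
      (left_mem_Icc.2 ha.le) (right_mem_Icc.2 ha.le) ha
  -- A whole ball about `σ + a • v` lies below the level; two nearby points are pushed into it along
  -- `v` and joined there by a segment.
  obtain ⟨δ, hδ, hδball⟩ := Metric.eventually_nhds_iff_ball.1
    (hdiff.continuous.continuousAt.eventually_lt continuousAt_const hdown)
  have hstep : ∀ x ∈ Metric.ball σ (r / 2), U x < U σ →
      JoinedIn {x | U x < U σ} x (x + a • v) := by
    intro x hx hxU
    refine JoinedIn.of_segment_subset ?_
    rw [segment_eq_image']
    rintro _ ⟨s, hs, rfl⟩
    have hs' : s * a ∈ Icc 0 a := ⟨mul_nonneg hs.1 ha.le, mul_le_of_le_one_left ha.le hs.2⟩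
    have := (hanti x a ha (hmem x hx)).antitoneOn (left_mem_Icc.2 ha.le) hs' hs'.1
    simp only [zero_smul, add_zero] at this
    simp only [mem_ofPred_eq, add_sub_cancel_left, smul_smul]
    exact this.trans_lt hxU
  refine ⟨Metric.ball σ (min (r / 2) δ), Metric.ball_mem_nhds _ (by positivity),
    fun x hx y hy hxU hyU => ?_⟩
  have hsub : ∀ x ∈ Metric.ball σ (min (r / 2) δ), x + a • v ∈ Metric.ball (σ + a • v) δ :=
    fun x hx => by simpa using (lt_min_iff.1 (Metric.mem_ball.1 hx)).2
  have hball' := Metric.ball_subset_ball (x := σ) (min_le_left (r / 2) δ)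
  refine ((hstep x (hball' hx) hxU).trans ?_).trans (hstep y (hball' hy) hyU).symm
  exact JoinedIn.of_segment_subset
    (((convex_ball _ _).segment_subset (hsub x hx) (hsub y hy)).trans hδball)

end LocalAnalysis

/-! ### The Hessian in its eigenbasis. -/

section Hessian

open Set

variable {d : ℕ} {U : EuclideanSpace ℝ (Fin d) → ℝ} {σ : EuclideanSpace ℝ (Fin d)}

theorem gradient_eq_zero_iff : gradient U σ = 0 ↔ fderiv ℝ U σ = 0 := by
  simp [gradient]

theorem isHermitian_hessian (hU : ContDiff ℝ 2 U) (σ : EuclideanSpace ℝ (Fin d)) :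
    (hessian U σ).IsHermitian := by
  ext i j
  have := (hU.contDiffAt (x := σ)).isSymmSndFDerivAt (by simp)
  simpa [hessian] using this.eq (EuclideanSpace.single j 1) (EuclideanSpace.single i 1)

theorem fderiv_fderiv_apply (v w : EuclideanSpace ℝ (Fin d)) :
    fderiv ℝ (fderiv ℝ U) σ v w = v.ofLp ⬝ᵥ (hessian U σ).mulVec w.ofLp := by
  have hsum : ∀ u : EuclideanSpace ℝ (Fin d), u = ∑ i, u i • EuclideanSpace.single i (1 : ℝ) := by
    intro u
    simpa using ((EuclideanSpace.basisFun (Fin d) ℝ).sum_repr u).symm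
  conv_lhs => rw [hsum v, hsum w]
  simp only [map_sum, map_smul, sum_apply, smul_apply,
    smul_eq_mul, dotProduct, Matrix.mulVec, hessian, Matrix.of_apply, Finset.mul_sum]
  rw [Finset.sum_comm]
  exact Finset.sum_congr rfl fun i _ => Finset.sum_congr rfl fun j _ => by ring

theorem fderiv_fderiv_apply_self (hH : (hessian U σ).IsHermitian)
    (v : EuclideanSpace ℝ (Fin d)) :
    fderiv ℝ (fderiv ℝ U) σ v v =
      ∑ i, hH.eigenvalues i * inner ℝ (hH.eigenvectorBasis i) v ^ 2 := by
  have hb : ∀ i, fderiv ℝ (fderiv ℝ U) σ v (hH.eigenvectorBasis i) =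
      hH.eigenvalues i * inner ℝ (hH.eigenvectorBasis i) v := by
    intro i
    rw [fderiv_fderiv_apply, hH.mulVec_eigenvectorBasis, dotProduct_smul]
    simp [EuclideanSpace.inner_eq_star_dotProduct]
  conv_lhs => enter [2]; rw [← hH.eigenvectorBasis.sum_repr' v]
  simp only [map_sum, map_smul, hb, smul_eq_mul]
  exact Finset.sum_congr rfl fun i _ => by ring

/-- The span of the eigenvectors of the Hessian with negative eigenvalue. -/
noncomputable def negSpace (hH : (hessian U σ).IsHermitian) :
    Submodule ℝ (EuclideanSpace ℝ (Fin d)) :=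
  Submodule.span ℝ (range fun i : {i // hH.eigenvalues i < 0} => hH.eigenvectorBasis i)

theorem finrank_negSpace (hH : (hessian U σ).IsHermitian) :
    Module.finrank ℝ (negSpace hH) = Fintype.card {i // hH.eigenvalues i < 0} :=
  finrank_span_eq_card
    (hH.eigenvectorBasis.orthonormal.linearIndependent.comp _ Subtype.val_injective)

theorem eigenvalues_ne_zero (hH : (hessian U σ).IsHermitian) (hdet : (hessian U σ).det ≠ 0)
    (i : Fin d) : hH.eigenvalues i ≠ 0 := by
  intro h
  rw [hH.det_eq_prod_eigenvalues] at hdet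
  exact hdet (Finset.prod_eq_zero (Finset.mem_univ i) (by simp [h]))

theorem exists_isMorseSplitting_negSpace (hU : ContDiff ℝ 2 U) (hσ : fderiv ℝ U σ = 0)
    (hH : (hessian U σ).IsHermitian) (hdet : (hessian U σ).det ≠ 0) :
    ∃ r, IsMorseSplitting U σ (negSpace hH) r := by
  -- `c` is the least absolute value of an eigenvalue; in dimension zero any positive number serves.
  obtain ⟨c, hc, hle⟩ : ∃ c : ℝ, 0 < c ∧ ∀ i, c ≤ |hH.eigenvalues i| := by
    have hpos : ∀ i, 0 < |hH.eigenvalues i| := fun i => abs_pos.2 (eigenvalues_ne_zero hH hdet i)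
    rcases isEmpty_or_nonempty (Fin d) with hd | hd
    · exact ⟨1, one_pos, fun i => hd.elim i⟩
    · obtain ⟨i, hi⟩ := Finite.exists_min fun i => |hH.eigenvalues i|
      exact ⟨_, hpos i, hi⟩
  have hnorm : ∀ v, c * ‖v‖ ^ 2 = ∑ i, c * inner ℝ (hH.eigenvectorBasis i) v ^ 2 := by
    intro v
    rw [← Finset.mul_sum, ← hH.eigenvectorBasis.sum_sq_norm_inner_right v]
    simp
  refine exists_isMorseSplitting hU hσ _ hc (fun v hv => ?_) (fun w hw => ?_)
  · rw [fderiv_fderiv_apply_self hH, hnorm, ← Finset.sum_neg_distrib]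
    refine Finset.sum_le_sum fun i _ => ?_
    rcases lt_or_gt_of_ne (eigenvalues_ne_zero hH hdet i) with hi | hi
    · have := hle i
      rw [abs_of_neg hi] at this
      nlinarith [sq_nonneg (inner ℝ (hH.eigenvectorBasis i) v)]
    · have : negSpace hH ≤ (ℝ ∙ hH.eigenvectorBasis i)ᗮ := by
        refine Submodule.span_le.2 ?_
        rintro _ ⟨j, rfl⟩
        rw [SetLike.mem_coe, Submodule.mem_orthogonal_singleton_iff_inner_right]
        refine hH.eigenvectorBasis.orthonormal.2 ?_
        rintro rfl
        exact lt_asymm hi j.2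
      rw [Submodule.mem_orthogonal_singleton_iff_inner_right.1 (this hv)]
      simp
  · rw [fderiv_fderiv_apply_self hH, hnorm]
    refine Finset.sum_le_sum fun i _ => ?_
    rcases lt_or_gt_of_ne (eigenvalues_ne_zero hH hdet i) with hi | hi
    · have hmem : hH.eigenvectorBasis i ∈ negSpace hH := Submodule.subset_span ⟨⟨i, hi⟩, rfl⟩
      rw [Submodule.inner_right_of_mem_orthogonal hmem hw]
      simp
    · have := hle i
      rw [abs_of_pos hi] at this
      exact mul_le_mul_of_nonneg_right this (sq_nonneg _)

end Hessian

/-! ### Communication height and sublevel sets. -/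

section CommunicationHeight

open Set

variable {d : ℕ} {U : EuclideanSpace ℝ (Fin d) → ℝ} {x y : EuclideanSpace ℝ (Fin d)}

theorem bddAbove_range_comp_path (hU : Continuous U) (z : Path x y) :
    BddAbove (range fun t => U (z t)) :=
  (isCompact_range (hU.comp z.continuous)).bddAbove

theorem left_le_iSup (hU : Continuous U) (z : Path x y) : U x ≤ ⨆ t, U (z t) := by
  simpa using le_ciSup (bddAbove_range_comp_path hU z) 0

theorem bddBelow_range_iSup (hU : Continuous U) :
    BddBelow (range fun z : Path x y => ⨆ t, U (z t)) :=
  ⟨U x, by rintro _ ⟨z, rfl⟩; exact left_le_iSup hU z⟩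

theorem commHeight_le (hU : Continuous U) (z : Path x y) {c : ℝ} (hz : ∀ t, U (z t) ≤ c) :
    commHeight U x y ≤ c :=
  (ciInf_le (bddBelow_range_iSup hU) z).trans (ciSup_le hz)

theorem right_le_commHeight (hU : Continuous U) : U y ≤ commHeight U x y :=
  haveI : Nonempty (Path x y) := PathConnectedSpace.joined x y
  le_ciInf fun z => by simpa using le_ciSup (bddAbove_range_comp_path hU z) 1

theorem commHeight_lt_iff (hU : Continuous U) {c : ℝ} :
    commHeight U x y < c ↔ JoinedIn {p | U p < c} x y := by
  have : Nonempty (Path x y) := PathConnectedSpace.joined x y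
  constructor
  · intro h
    obtain ⟨z, hz⟩ := exists_lt_of_ciInf_lt h
    exact ⟨z, fun t => (le_ciSup (bddAbove_range_comp_path hU z) t).trans_lt hz⟩
  · rintro ⟨z, hz⟩
    obtain ⟨t, ht⟩ := (isCompact_univ.exists_isMaxOn univ_nonempty
      (hU.comp z.continuous).continuousOn)
    exact (commHeight_le hU z fun s => ht.2 (mem_univ s)).trans_lt (hz t)

theorem isCompact_sublevel (hU : IsAdmissible U) (c : ℝ) : IsCompact {p | U p ≤ c} := by
  refine Metric.isCompact_of_isClosed_isBounded
    (isClosed_le hU.contDiff.continuous continuous_const) ?_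
  have h1 := hU.superlinear.eventually_ge_atTop 1
  have h2 : ∀ᶠ p in Bornology.cobounded (EuclideanSpace ℝ (Fin d)), max c 0 < ‖p‖ :=
    tendsto_norm_cobounded_atTop.eventually_gt_atTop _
  rw [← Bornology.isCobounded_compl_iff]
  change _ ∈ Bornology.cobounded _
  filter_upwards [h1, h2] with p hp1 hp2
  have hp0 : 0 < ‖p‖ := (le_max_right c 0).trans_lt hp2
  rw [one_le_div hp0] at hp1
  simpa using ((le_max_left c 0).trans_lt hp2).trans_le hp1

/-- If the sublevel set of height `c` is split by disjoint closed sets, one containing `x` and the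
other `y`, then every path from `x` to `y` climbs well above `c`. -/
theorem lt_commHeight_of_subset_union (hU : IsAdmissible U) {c : ℝ}
    {C D : Set (EuclideanSpace ℝ (Fin d))} (hC : IsClosed C) (hD : IsClosed D)
    (hCD : Disjoint C D) (hsub : {p | U p ≤ c} ⊆ C ∪ D) (hx : x ∈ C) (hy : y ∈ D) :
    c < commHeight U x y := by
  have hcont := hU.contDiff.continuous
  obtain ⟨O₁, O₂, hO₁, hO₂, hC₁, hD₂, hO⟩ := normal_separation hC hD hCD
  have hK : IsCompact ({p | U p ≤ c + 1} \ (O₁ ∪ O₂)) :=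
    (isCompact_sublevel hU _).diff (hO₁.union hO₂)
  -- Outside the two open sets, the minimum of `U` over the compact remainder exceeds `c`, which
  -- leaves room for a level `e` above `c`.
  obtain ⟨e, he, hle⟩ : ∃ e, c < e ∧ {p | U p < e} ⊆ O₁ ∪ O₂ := by
    rcases ({p | U p ≤ c + 1} \ (O₁ ∪ O₂)).eq_empty_or_nonempty with hK0 | hK0
    · refine ⟨c + 1, by linarith, fun p hp => ?_⟩
      by_contra hpO
      have hpc : U p < c + 1 := hp
      exact (Set.eq_empty_iff_forall_notMem.1 hK0 p) ⟨hpc.le, hpO⟩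
    · obtain ⟨q, hq, hmin⟩ := hK.exists_isMinOn hK0 hcont.continuousOn
      have hqc : c < U q := by
        by_contra hqc
        exact hq.2 (union_subset_union hC₁ hD₂ (hsub (not_lt.1 hqc)))
      refine ⟨U q, hqc, fun p hp => ?_⟩
      by_contra hpO
      have hpq : U p < U q := hp
      have hqp : U q ≤ U p := hmin ⟨hpq.le.trans hq.1, hpO⟩
      exact hpq.not_ge hqp
  refine lt_of_lt_of_le he (not_lt.1 fun hlt => ?_)
  obtain ⟨z, hz⟩ := (commHeight_lt_iff hcont).1 hlt
  have hpre : IsPreconnected (range z) := isPreconnected_range z.continuous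
  obtain ⟨p, -, hp₁, hp₂⟩ := hpre O₁ O₂ hO₁ hO₂ (range_subset_iff.2 fun t => hle (hz t))
    ⟨x, ⟨0, z.source⟩, hC₁ hx⟩ ⟨y, ⟨1, z.target⟩, hD₂ hy⟩
  exact disjoint_left.1 hO hp₁ hp₂

end CommunicationHeight

/-! ### Optimal paths and their highest points. -/

section OptimalPaths

open Set

/-- Path components of an open set are open, hence also closed relative to it. -/
theorem mem_pathComponentIn_of_mem_closure {X : Type*} [TopologicalSpace X]
    [LocallyPathConnectedSpace X] {F : Set X} (hF : IsOpen F) {x y : X}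
    (hy : y ∈ closure (pathComponentIn F x)) (hyF : y ∈ F) : y ∈ pathComponentIn F x := by
  obtain ⟨p, hyp, hxp⟩ := mem_closure_iff.1 hy _ (hF.pathComponentIn y)
    (mem_pathComponentIn_self hyF)
  exact JoinedIn.trans hxp (JoinedIn.symm hyp)

variable {d : ℕ} {U : EuclideanSpace ℝ (Fin d) → ℝ} {m m' σ : EuclideanSpace ℝ (Fin d)}

theorem IsAdmissible.exists_isMorseSplitting (hU : IsAdmissible U) (hσ : fderiv ℝ U σ = 0)
    (hH : (hessian U σ).IsHermitian) : ∃ r, IsMorseSplitting U σ (negSpace hH) r :=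
  exists_isMorseSplitting_negSpace (hU.contDiff.of_le (by norm_num)) hσ hH
    (hU.nondegenerate σ (gradient_eq_zero_iff.2 hσ))

theorem IsAdmissible.isHermitian (hU : IsAdmissible U) (σ : EuclideanSpace ℝ (Fin d)) :
    (hessian U σ).IsHermitian :=
  isHermitian_hessian (hU.contDiff.of_le (by norm_num)) σ

theorem IsAdmissible.finite_isLocalMin (hU : IsAdmissible U) : {x | IsLocalMin U x}.Finite :=
  hU.finite_critical.subset fun _ hx => gradient_eq_zero_iff.2 (IsLocalMin.fderiv_eq_zero hx)

theorem IsAdmissible.exists_forall_lt (hU : IsAdmissible U) (hm : IsLocalMin U m) :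
    ∃ r > 0, ∀ x ∈ Metric.ball m r, x ≠ m → U m < U x := by
  obtain ⟨r, hr⟩ := hU.exists_isMorseSplitting hm.fderiv_eq_zero (hU.isHermitian m)
  have hr' := hr
  rw [hr.eq_bot_of_isLocalMin hm] at hr'
  exact ⟨r, hr.pos, fun x hx hne => hr'.lt_of_bot hne (mem_ball_iff_norm.1 hx)⟩

theorem lt_commHeight_of_isLocalMin (hU : IsAdmissible U) (hm : IsLocalMin U m) (hne : m' ≠ m) :
    U m < commHeight U m m' := by
  have hcont := hU.contDiff.continuous
  rcases lt_or_ge (U m) (U m') with hlt | hle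
  · exact hlt.trans_le (right_le_commHeight hcont)
  obtain ⟨r, hr, hball⟩ := hU.exists_forall_lt hm
  have hmem : ∀ x, U x ≤ U m → x ≠ m → x ∈ (Metric.ball m r)ᶜ :=
    fun x hx hxm hxr => (hball x hxr hxm).not_ge hx
  -- When `U m' ≤ U m`, strictness of the minimum isolates `m` in `{U ≤ U m}`.
  refine lt_commHeight_of_subset_union hU isClosed_singleton Metric.isOpen_ball.isClosed_compl
    (disjoint_singleton_left.2 fun h => h (Metric.mem_ball_self hr)) (fun x hx => ?_)
    (mem_singleton m) (hmem m' hle hne)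
  rcases eq_or_ne x m with rfl | hxm
  · exact Or.inl rfl
  · exact Or.inr (hmem x hx hxm)

/-- There are finitely many local minima, so the infimum in `depth` is attained. -/
theorem depth_spec (hU : IsAdmissible U) (hother : ∃ m', IsLocalMin U m' ∧ m' ≠ m) :
    (∃ m', IsLocalMin U m' ∧ m' ≠ m ∧ commHeight U m m' = U m + depth U m) ∧
      ∀ m', IsLocalMin U m' → m' ≠ m → U m + depth U m ≤ commHeight U m m' := by
  have hfin : (commHeight U m '' {m' | IsLocalMin U m' ∧ m' ≠ m}).Finite :=
    (hU.finite_isLocalMin.subset fun _ h => h.1).image _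
  have hne : (commHeight U m '' {m' | IsLocalMin U m' ∧ m' ≠ m}).Nonempty := by
    obtain ⟨m', h⟩ := hother
    exact ⟨_, m', h, rfl⟩
  have heq : U m + depth U m = sInf (commHeight U m '' {m' | IsLocalMin U m' ∧ m' ≠ m}) := by
    simp [depth]
  rw [heq]
  obtain ⟨m', ⟨h1, h2⟩, h3⟩ := hne.csInf_mem hfin
  exact ⟨⟨m', h1, h2, h3⟩, fun p hp hpm => csInf_le hfin.bddBelow ⟨p, ⟨hp, hpm⟩, rfl⟩⟩

/-- Each component of a strict sublevel set contains a local minimum. -/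
theorem exists_isLocalMin_joinedIn (hU : IsAdmissible U) {c : ℝ} {y : EuclideanSpace ℝ (Fin d)}
    (hy : U y < c) : ∃ p, IsLocalMin U p ∧ JoinedIn {x | U x < c} y p := by
  have hcont := hU.contDiff.continuous
  have hF : IsOpen {x | U x < c} := isOpen_lt hcont continuous_const
  set B := pathComponentIn {x | U x < c} y
  have hBsub : B ⊆ {x | U x ≤ c} := fun x hx => by
    have hlt : U x < c := pathComponentIn_subset (F := {x | U x < c}) hx
    exact hlt.le
  have hcpt : IsCompact (closure B) :=
    (isCompact_sublevel hU c).of_isClosed_subset isClosed_closure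
      (closure_minimal hBsub (isClosed_le hcont continuous_const))
  have hyB : y ∈ B := mem_pathComponentIn_self hy
  obtain ⟨p, hp, hmin⟩ := hcpt.exists_isMinOn ⟨y, subset_closure hyB⟩ hcont.continuousOn
  have hpy : U p ≤ U y := hmin (subset_closure hyB)
  have hpB : p ∈ B := mem_pathComponentIn_of_mem_closure hF hp (hpy.trans_lt hy)
  exact ⟨p, (hmin.on_subset subset_closure).isLocalMin ((hF.pathComponentIn y).mem_nhds hpB), hpB⟩

/-- At the optimal height, the component of `m` in the strict sublevel set touches the rest of
the sublevel set. -/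
theorem exists_mem_closure_inter_closure (hU : IsAdmissible U) {c : ℝ} (hmc : U m < c)
    (hm' : IsLocalMin U m') (hheight : commHeight U m m' = c) :
    ∃ σ, σ ∈ closure (pathComponentIn {x | U x < c} m) ∧
      σ ∈ closure ({x | U x < c} \ pathComponentIn {x | U x < c} m) := by
  have hcont := hU.contDiff.continuous
  have hF : IsOpen {x | U x < c} := isOpen_lt hcont continuous_const
  set A := pathComponentIn {x | U x < c} m with hA
  have hAF : A ⊆ {x | U x < c} := pathComponentIn_subset
  by_contra! hcon
  have hminA : ∀ x, IsLocalMin U x → U x = c → x ∉ closure A := by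
    intro x hx hxc hxA
    obtain ⟨p, hpx, hpA⟩ := mem_closure_iff_nhds.1 hxA _ hx
    have h1 : U x ≤ U p := hpx
    have h2 : U p < c := hAF hpA
    linarith
  -- Minima at height exactly `c` are not limits of `{U < c}`, so they are added separately; being
  -- finitely many, they keep `D` closed.
  let D := closure ({x | U x < c} \ A) ∪ {x | IsLocalMin U x ∧ U x = c}
  have hD : IsClosed D :=
    isClosed_closure.union (hU.finite_isLocalMin.subset fun _ h => h.1).isClosed
  have hdisj : Disjoint (closure A) D := by
    refine disjoint_left.2 fun x hx hxD => ?_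
    rcases hxD with h | h
    · exact hcon x hx h
    · exact hminA x h.1 h.2 hx
  have hsub : {x | U x ≤ c} ⊆ closure A ∪ D := by
    intro x hx
    have hdich : ∀ p, U p < c → p ∈ A ∪ ({x | U x < c} \ A) := fun p hp => by
      by_cases hpA : p ∈ A
      · exact Or.inl hpA
      · exact Or.inr ⟨hp, hpA⟩
    have hcl : x ∈ closure {x | U x < c} → x ∈ closure A ∪ D := by
      intro h
      rcases closure_union.subset (closure_mono (fun p hp => hdich p hp) h) with h | h
      · exact Or.inl h
      · exact Or.inr (Or.inl h)
    have hxc : U x ≤ c := hx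
    rcases lt_or_eq_of_le hxc with hlt | heq
    · exact hcl (subset_closure hlt)
    by_cases hloc : IsLocalMin U x
    · exact Or.inr (Or.inr ⟨hloc, heq⟩)
    · refine hcl (mem_closure_iff_frequently.2 ?_)
      simpa [IsLocalMin, IsMinFilter, heq] using hloc
  have hm'c : U m' ≤ c := hheight ▸ right_le_commHeight hcont
  have hm'A : m' ∉ closure A := by
    intro h
    rcases lt_or_eq_of_le hm'c with hlt | heq
    · have := (commHeight_lt_iff hcont).2 (mem_pathComponentIn_of_mem_closure hF h hlt)
      exact this.ne hheight
    · exact hminA m' hm' heq h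
  exact (lt_commHeight_of_subset_union hU isClosed_closure hD hdisj hsub
    (subset_closure (mem_pathComponentIn_self hmc))
    ((hsub hm'c).resolve_left hm'A)).ne' hheight

theorem exists_isOptimalPath (hU : IsAdmissible U) (hm : IsLocalMin U m)
    (hother : ∃ m', IsLocalMin U m' ∧ m' ≠ m) :
    ∃ m', IsLocalMin U m' ∧ m' ≠ m ∧ ∃ z : Path m m', IsOptimalPath U z := by
  have hcont := hU.contDiff.continuous
  obtain ⟨⟨m₁, hm₁, hne₁, hheight⟩, hle⟩ := depth_spec hU hother
  set c := U m + depth U m with hc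
  have hmc : U m < c := hheight ▸ lt_commHeight_of_isLocalMin hU hm hne₁
  have hF : IsOpen {x | U x < c} := isOpen_lt hcont continuous_const
  obtain ⟨σ, hσA, hσB⟩ := exists_mem_closure_inter_closure hU hmc hm₁ hheight
  have hσc : U σ = c := by
    refine le_antisymm ?_ (not_lt.1 fun hlt => ?_)
    · refine closure_minimal (t := {x | U x ≤ c}) (fun x hx => ?_)
        (isClosed_le hcont continuous_const) hσA
      have hlt : U x < c := pathComponentIn_subset (F := {x | U x < c}) hx
      exact hlt.le
    · obtain ⟨p, hpA, hpB⟩ := mem_closure_iff.1 hσB _ (hF.pathComponentIn m)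
        (mem_pathComponentIn_of_mem_closure hF hσA hlt)
      exact hpB.2 hpA
  rw [← hσc] at hσA hσB hmc
  have hσ : fderiv ℝ U σ = 0 := by
    by_contra hσ
    obtain ⟨W, hW, hjoin⟩ :=
      eventually_joinedIn_of_fderiv_ne_zero (hU.contDiff.of_le (by norm_num)) hσ
    obtain ⟨x, hxW, hxA⟩ := mem_closure_iff_nhds.1 hσA W hW
    obtain ⟨y, hyW, hyB⟩ := mem_closure_iff_nhds.1 hσB W hW
    exact hyB.2 (JoinedIn.trans hxA (hjoin x hxW y hyW (pathComponentIn_subset hxA :) hyB.1))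
  obtain ⟨r, hr⟩ := hU.exists_isMorseSplitting hσ (hU.isHermitian σ)
  obtain ⟨x, hxr, hxA⟩ := mem_closure_iff_nhds.1 hσA _ (Metric.ball_mem_nhds σ hr.pos)
  obtain ⟨y, hyr, hyB⟩ := mem_closure_iff_nhds.1 hσB _ (Metric.ball_mem_nhds σ hr.pos)
  -- The component of `y` differs from that of `m`, so its minimum `p` is not `m`.
  obtain ⟨p, hp, hyp⟩ := exists_isLocalMin_joinedIn hU hyB.1
  have hpm : p ≠ m := by
    rintro rfl
    exact hyB.2 hyp.symm
  obtain ⟨γ₁, hγ₁⟩ := hr.exists_path (y := m) (mem_ball_iff_norm.1 hxr)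
    (by rw [add_sub_cancel]; exact hxA)
  obtain ⟨γ₂, hγ₂⟩ := hr.exists_path (y := p) (mem_ball_iff_norm.1 hyr)
    (by rw [add_sub_cancel]; exact hyp.symm)
  have hhalf : (γ₁.trans γ₂.symm) half = σ := by
    have hle : (half : ℝ) ≤ 1 / 2 := le_rfl
    rw [Path.trans_apply, dif_pos hle]
    exact (congrArg γ₁ (Subtype.ext (by simp [half]))).trans γ₁.target
  have hlt : ∀ s, s ≠ half → U ((γ₁.trans γ₂.symm) s) < U σ := by
    intro s hs
    have hs' : (s : ℝ) ≠ 1 / 2 := fun h => hs (Subtype.ext h)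
    rw [Path.trans_apply]
    split_ifs with h
    · refine hγ₁ _ fun h1 => hs' ?_
      have := congrArg Subtype.val h1
      simp only [Set.Icc.coe_one] at this
      linarith
    · refine hγ₂ _ fun h1 => hs' ?_
      have := congrArg Subtype.val h1
      simp only [Set.Icc.coe_one, unitInterval.coe_symm_eq] at this
      linarith
  have hmax : ∀ s, U ((γ₁.trans γ₂.symm) s) ≤ U σ := by
    intro s
    rcases eq_or_ne s half with rfl | hs
    · rw [hhalf]
    · exact (hlt s hs).le
  refine ⟨p, hp, hpm, γ₁.trans γ₂.symm, ⟨⟨half, rfl⟩, ?_⟩, ?_, ?_, ?_⟩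
  · rintro _ ⟨s, rfl⟩
    simpa only [hhalf] using hmax s
  · rw [hhalf, hσc]
  -- The path bounds the height to `p` by `c`; the minimality in `depth` gives the reverse.
  · exact le_antisymm (hle p hp hpm) (hc ▸ hσc ▸ commHeight_le hcont _ hmax)
  · rw [hhalf]
    exact hlt

/-- An optimal path cannot be short-cut below its highest point. -/
theorem IsOptimalPath.not_eventually_joinedIn (hU : Continuous U) {z : Path m m'}
    (hz : IsOptimalPath U z) {W : Set (EuclideanSpace ℝ (Fin d))} (hW : W ∈ 𝓝 (z half)) :
    ¬ ∀ x ∈ W, ∀ y ∈ W, U x < U (z half) → U y < U (z half) →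
      JoinedIn {x | U x < U (z half)} x y := by
  intro hjoin
  set c := U (z half) with hc
  have hext : z.extend (1 / 2) = z half := z.extend_apply half.2
  have hlt : ∀ t ∈ Icc (0 : ℝ) 1, t ≠ 1 / 2 → U (z.extend t) < c := by
    intro t ht hne
    rw [z.extend_apply ht]
    exact hz.lt_of_ne _ fun h => hne (congrArg Subtype.val h)
  rw [← hext] at hW
  obtain ⟨ε, hε, hball⟩ := Metric.mem_nhds_iff.1 (z.continuous_extend.continuousAt hW)
  -- Both times `1 / 2 ± a` lie in `[0, 1]` and are mapped into `W`.
  set a := min (ε / 2) (1 / 4) with ha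
  have ha0 : 0 < a := by positivity
  have haε : a < ε := (min_le_left _ _).trans_lt (by linarith)
  have ha4 : a ≤ 1 / 4 := min_le_right _ _
  have h1 : z.extend (1 / 2 - a) ∈ W := hball (by simp [abs_of_pos ha0, haε])
  have h2 : z.extend (1 / 2 + a) ∈ W := hball (by simp [abs_of_pos ha0, haε])
  have hpiece : ∀ u v : ℝ, u ≤ v → Icc u v ⊆ Icc 0 1 → (1 / 2 : ℝ) ∉ Icc u v →
      JoinedIn {x | U x < c} (z.extend u) (z.extend v) := by
    intro u v huv hsub hnot
    refine (((convex_Icc u v).isPathConnected ⟨u, left_mem_Icc.2 huv⟩).joinedIn u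
      (left_mem_Icc.2 huv) v (right_mem_Icc.2 huv)).map z.continuous_extend |>.mono ?_
    rintro _ ⟨t, ht, rfl⟩
    exact hlt t (hsub ht) fun h => hnot (h ▸ ht)
  have hj1 := hpiece 0 (1 / 2 - a) (by linarith) (Icc_subset_Icc le_rfl (by linarith))
    fun h => by linarith [h.2]
  have hj2 := hpiece (1 / 2 + a) 1 (by linarith) (Icc_subset_Icc (by linarith) le_rfl)
    fun h => by linarith [h.1]
  have hj := (hj1.trans (hjoin _ h1 _ h2 hj1.target_mem hj2.source_mem)).trans hj2
  rw [z.extend_zero, z.extend_one] at hj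
  have := (commHeight_lt_iff hU).2 hj
  exact this.ne (hz.eq_commHeight.symm.trans hz.eq_depth.symm)

theorem IsOptimalPath.isSaddlePoint (hU : IsAdmissible U) {z : Path m m'}
    (hz : IsOptimalPath U z) : IsSaddlePoint U (z half) := by
  have hcont := hU.contDiff.continuous
  have hσ : fderiv ℝ U (z half) = 0 := by
    by_contra hσ
    obtain ⟨W, hW, hjoin⟩ :=
      eventually_joinedIn_of_fderiv_ne_zero (hU.contDiff.of_le (by norm_num)) hσ
    exact hz.not_eventually_joinedIn hcont hW hjoin
  have hH := hU.isHermitian (z half)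
  have hne := eigenvalues_ne_zero hH (hU.nondegenerate _ (gradient_eq_zero_iff.2 hσ))
  obtain ⟨r, hr⟩ := hU.exists_isMorseSplitting hσ hH
  have hcard_le : Fintype.card {i // hH.eigenvalues i < 0} ≤ 1 := by
    by_contra! hcard
    rw [← finrank_negSpace] at hcard
    obtain ⟨W, hW, hjoin⟩ := hr.eventually_joinedIn (Module.one_lt_rank_of_one_lt_finrank hcard)
    exact hz.not_eventually_joinedIn hcont hW hjoin
  have hnonempty : Nonempty {i // hH.eigenvalues i < 0} := by
    by_contra hempty
    rw [not_nonempty_iff] at hempty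
    have hbot : negSpace hH = ⊥ := by simp [negSpace, range_eq_empty]
    rw [hbot] at hr
    -- At index zero `z half` is a local minimum, so the joining condition is vacuous.
    refine hz.not_eventually_joinedIn hcont (Metric.ball_mem_nhds _ hr.pos)
      fun x hx _ _ hxlt => absurd hxlt (not_lt.2 ?_)
    rcases eq_or_ne x (z half) with rfl | hxne
    · exact le_rfl
    · exact (hr.lt_of_bot hxne (mem_ball_iff_norm.1 hx)).le
  obtain ⟨⟨i, hi⟩⟩ := hnonempty
  refine ⟨gradient_eq_zero_iff.2 hσ, hH, i, hi, fun j hj => ?_⟩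
  refine lt_of_le_of_ne (not_lt.1 fun hjneg => hj ?_) (hne j).symm
  exact congrArg Subtype.val (Fintype.card_le_one_iff.1 hcard_le ⟨j, hjneg⟩ ⟨i, hi⟩)

end OptimalPaths

end MorsePotential

theorem propositionA1 {d : ℕ} (U : EuclideanSpace ℝ (Fin d) → ℝ)
    (hU : MorsePotential.IsAdmissible U)
    (m : EuclideanSpace ℝ (Fin d)) (hm : IsLocalMin U m)
    (hother : ∃ m', IsLocalMin U m' ∧ m' ≠ m) :
    (∃ m', IsLocalMin U m' ∧ m' ≠ m ∧
      ∃ z : Path m m', MorsePotential.IsOptimalPath U z) ∧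
    (∀ m', IsLocalMin U m' → m' ≠ m →
      ∀ z : Path m m', MorsePotential.IsOptimalPath U z →
        MorsePotential.IsSaddlePoint U (z MorsePotential.half)) :=
  ⟨MorsePotential.exists_isOptimalPath hU hm hother, fun _ _ _ _ hz => hz.isSaddlePoint hU⟩
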